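/- All algebras are associative unital $\mathbb{C}$-algebras, and locally convex spaces are complex; complete ones are Hausdorff. An *Arens–Michael algebra* is a complete algebra whose topology is defined by a family of submultiplicative seminorms; its *$\hat\otimes$-bimodules* are the complete locally convex spaces with jointly continuous left and right actions making them bimodules. An *Arens–Michael envelope* $(\widehat A,i_A)$ of an algebra $A$ is an Arens–Michael algebra $\widehat A$ with an algebra homomorphism $i_A:A\to\widehat A$ through which every algebra homomorphism from $A$ to an Arens–Michael algebra factors by a unique continuous algebra homomorphism. An *Arens–Michael envelope* $(\widehat M,i_M)$ of an $A$-bimodule $M$ is an $\widehat A$-$\hat\otimes$-bimodule with an $A$-bimodule homomorphism $i_M:M\to\widehat M$ through which every $A$-bimodule homomorphism from $M$ to an $\widehat A$-$\hat\otimes$-bimodule factors by a unique continuous $\widehat A$-bimodule homomorphism. $A$-bimodules $M$ and $M^{-1}$ are *inverse* if they come with bimodule isomorphisms $i_1:M\otimes_A M^{-1}\to A$ and $i_2:M^{-1}\otimes_A M\to A$ such that $i_1(m\otimes n)m'=m\,i_2(n\otimes m')$ and $i_2(n\otimes m)n'=n\,i_1(m\otimes n')$. Then $L_A(M)=\bigoplus_{n\in\mathbb{Z}}M^{\otimes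 n}$ (tensor powers over $A$, with $M^{\otimes 0}=A$ and $M^{\otimes -n}=(M^{-1})^{\otimes n}$) is the *Laurent tensor algebra*; its multiplication extends those of the tensor algebras $T_A(M)$ and $T_A(M^{-1})$ and satisfies $m\cdot n=i_1(m\otimes n)$ and $n\cdot m=i_2(n\otimes m)$ for $m\in M$, $n\in M^{-1}$. *Topologically inverse* $R$-$\hat\otimes$-bimodules $P,Q$ over an Arens–Michael algebra $R$ are defined in the same way with the completed projective tensor product $\hat\otimes_R$ and topological bimodule isomorphisms $\hat i_1:P\hat\otimes_R Q\to R$, $\hat i_2:Q\hat\otimes_R P\to R$. A *topologically compatible triple* $(\theta,\alpha,\beta,B)$ consists of an Arens–Michael algebra $B$, a continuous homomorphism $\theta:R\to B$ and continuous $R$-bimodule homomorphisms $\alpha:P\to B$, $\beta:Q\to B$ with $\theta(\hat i_1(p\otimes q))=\alpha(p)\beta(q)$ and $\theta(\hat i_2(q\otimes p))=\beta(q)\alpha(p)$ for all $p\in P$, $q\in Q$. A universal (initial) such triple $(\theta,\alpha,\beta,\widehat L_R(P))$ is a *topological Laurent tensor algebra*: every topologically compatible triple $(\theta',\alpha',\beta',B)$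 is $(f\theta,f\alpha,f\beta,B)$ for a unique continuous algebra homomorphism $f:\widehat L_R(P)\to B$. **Proposition.** Let $A$ be an algebra and let $M$, $M^{-1}$ be inverse $A$-bimodules with respect to $i_1,i_2$. Let $(\widehat A,i_A)$, $(\widehat M,i_M)$, $(\widehat{M^{-1}},i_{M^{-1}})$ be Arens–Michael envelopes of $A$, $M$, $M^{-1}$. Suppose that 1. the underlying locally convex spaces of $\widehat A$, $\widehat M$ and $\widehat{M^{-1}}$ are Fréchet spaces; 2. $\widehat M$ and $\widehat{M^{-1}}$ are topologically inverse $\widehat A$-$\hat\otimes$-bimodules with respect to isomorphisms $\hat i_1,\hat i_2$ such that $\hat i_1(i_M(m)\otimes i_{M^{-1}}(n))=i_A(i_1(m\otimes n))$ and $\hat i_2(i_{M^{-1}}(n)\otimes i_M(m))=i_A(i_2(n\otimes m))$ for all $m\in M$, $n\in M^{-1}$. Let $(\theta,\alpha,\beta,\widehat L_{\widehat A}(\widehat M))$ be a topological Laurent tensor algebra of $\widehat M,\widehat{M^{-1}}$ over $\widehat A$. Then there is an algebra homomorphism $\iota:L_A(M)\to\widehat L_{\widehat A}(\widehat M)$ which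 restricts to $\theta i_A$ on $A$, to $\alpha i_M$ on $M$ and to $\beta i_{M^{-1}}$ on $M^{-1}$, and $(\widehat L_{\widehat A}(\widehat M),\iota)$ is an Arens–Michael envelope of $L_A(M)$. Consequently, for every Arens–Michael envelope $(\widehat{L_A(M)},j)$ of $L_A(M)$ there is a topological algebra isomorphism $e:\widehat{L_A(M)}\to\widehat L_{\widehat A}(\widehat M)$ with $e\circ j=\iota$. -/

import Mathlib

open MulOpposite TensorProduct

universe u

namespace LaurentAM

/-! ### The tensor product of bimodules over a noncommutative algebra

Throughout, an algebra is an associative unital `ℂ`-algebra `A`.  A left `A`-module is a complex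
vector space with a compatible `Module A` structure, a right `A`-module one with a compatible
`Module Aᵐᵒᵖ` structure, so that `m · a` is written `op a • m`. -/

section Tensor

/-- The subspace of `M ⊗[ℂ] X` spanned by all `m a ⊗ x - m ⊗ a x`. -/
def balancingRelations (A M X : Type u) [Ring A] [AddCommGroup M] [Module ℂ M] [Module Aᵐᵒᵖ M]
    [AddCommGroup X] [Module ℂ X] [Module A X] : Submodule ℂ (M ⊗[ℂ] X) :=
  Submodule.span ℂ {t | ∃ (m : M) (a : A) (x : X), t = (op a • m) ⊗ₜ[ℂ] x - m ⊗ₜ[ℂ] (a • x)}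

/-- The algebraic tensor product `M ⊗_A X` of a right `A`-module and a left `A`-module. -/
def TensorOver (A M X : Type u) [Ring A] [AddCommGroup M] [Module ℂ M] [Module Aᵐᵒᵖ M]
    [AddCommGroup X] [Module ℂ X] [Module A X] : Type u :=
  (M ⊗[ℂ] X) ⧸ balancingRelations A M X

namespace TensorOver

variable {A M X : Type u} [Ring A] [AddCommGroup M] [Module ℂ M] [Module Aᵐᵒᵖ M]
  [AddCommGroup X] [Module ℂ X] [Module A X]

instance : AddCommGroup (TensorOver A M X) :=
  inferInstanceAs (AddCommGroup ((M ⊗[ℂ] X) ⧸ balancingRelations A M X))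

instance : Module ℂ (TensorOver A M X) :=
  inferInstanceAs (Module ℂ ((M ⊗[ℂ] X) ⧸ balancingRelations A M X))

variable (A M X) in
/-- The canonical bilinear map `(m, x) ↦ m ⊗ x`. -/
def mk : M →ₗ[ℂ] X →ₗ[ℂ] TensorOver A M X :=
  (TensorProduct.mk ℂ M X).compr₂ (balancingRelations A M X).mkQ

variable (A) in
/-- The elementary tensor `m ⊗ x` in `M ⊗_A X`. -/
def tmul (m : M) (x : X) : TensorOver A M X := mk A M X m x

theorem tmul_balanced (m : M) (a : A) (x : X) : tmul A (op a • m) x = tmul A m (a • x) :=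
  (Submodule.Quotient.eq _).2 (Submodule.subset_span ⟨m, a, x, rfl⟩)

variable {Y : Type u} [AddCommGroup Y] [Module ℂ Y]

/-- A balanced bilinear map factors through `M ⊗_A X`. -/
def lift (f : M →ₗ[ℂ] X →ₗ[ℂ] Y) (hf : ∀ (m : M) (a : A) (x : X), f (op a • m) x = f m (a • x)) :
    TensorOver A M X →ₗ[ℂ] Y :=
  (balancingRelations A M X).liftQ (TensorProduct.lift f) (by
    refine Submodule.span_le.2 ?_
    rintro _ ⟨m, a, x, rfl⟩
    simp [hf])

@[simp] theorem lift_tmul (f : M →ₗ[ℂ] X →ₗ[ℂ] Y)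
    (hf : ∀ (m : M) (a : A) (x : X), f (op a • m) x = f m (a • x)) (m : M) (x : X) :
    lift f hf (tmul A m x) = f m x := by
  exact TensorProduct.lift.tmul m x

theorem induction_on {P : TensorOver A M X → Prop} (t : TensorOver A M X)
    (h0 : P 0) (ht : ∀ m x, P (tmul A m x)) (ha : ∀ s t, P s → P t → P (s + t)) : P t := by
  obtain ⟨t, rfl⟩ := (balancingRelations A M X).mkQ_surjective t
  induction t with
  | zero => exact h0
  | tmul m x => exact ht m x
  | add s t hs ht => exact ha _ _ hs ht

theorem linearMap_ext {f g : TensorOver A M X →ₗ[ℂ] Y}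
    (h : ∀ m x, f (tmul A m x) = g (tmul A m x)) : f = g := by
  ext t
  induction t using induction_on with
  | h0 => simp
  | ht m x => exact h m x
  | ha s t hs ht => simp [hs, ht]

section LeftAction

variable [Algebra ℂ A] [Module A M] [IsScalarTower ℂ A M] [SMulCommClass A Aᵐᵒᵖ M]

theorem smul_balanced (a : A) (m : M) (b : A) (x : X) :
    (mk A M X).comp (Algebra.lsmul ℂ ℂ M a) (op b • m) x =
      (mk A M X).comp (Algebra.lsmul ℂ ℂ M a) m (b • x) := by
  change tmul A (a • op b • m) x = tmul A (a • m) (b • x)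
  rw [smul_comm, tmul_balanced]

/-- The left action `a (m ⊗ x) = (a m) ⊗ x` when `M` is a bimodule. -/
def leftAction : A →+* Module.End ℂ (TensorOver A M X) where
  toFun a := lift ((mk A M X).comp (Algebra.lsmul ℂ ℂ M a)) (smul_balanced a)
  map_one' := linearMap_ext fun m x => by
    rw [lift_tmul]; simp [tmul]
  map_mul' a b := linearMap_ext fun m x => by
    rw [lift_tmul, Module.End.mul_apply, lift_tmul]
    refine Eq.trans ?_ (lift_tmul _ _ (b • m) x).symm
    simp
  map_zero' := linearMap_ext fun m x => by
    rw [lift_tmul]; simp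
  map_add' a b := linearMap_ext fun m x => by
    rw [LinearMap.add_apply, lift_tmul, lift_tmul, lift_tmul]
    simp

instance : Module A (TensorOver A M X) := Module.compHom _ (leftAction (A := A) (M := M) (X := X))

theorem smul_tmul (a : A) (m : M) (x : X) : a • tmul A m x = tmul A (a • m) x := by
  change leftAction a (tmul A m x) = _
  exact lift_tmul ((mk A M X).comp (Algebra.lsmul ℂ ℂ M a)) (smul_balanced a) m x

instance : IsScalarTower ℂ A (TensorOver A M X) where
  smul_assoc c a t := by
    induction t using induction_on with
    | h0 => simp
    | ht m x => rw [smul_tmul, smul_tmul, smul_assoc]; simp [tmul]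
    | ha s t hs ht => simp [smul_add, hs, ht]

end LeftAction

end TensorOver

end Tensor

/-! ### Inverse bimodules -/

/-- The data making `N` an inverse `M⁻¹` of the `A`-bimodule `M`: bimodule isomorphisms
`conv₁ : M ⊗_A N ≃ A` and `conv₂ : N ⊗_A M ≃ A` (the convolutions) making the two associativity
squares on `M ⊗_A N ⊗_A M` and `N ⊗_A M ⊗_A N` commute.  Left and right `A`-linearity and the
commutativity of the squares are spelled out on elementary tensors, which span. -/
structure InverseBimodules (A M N : Type u) [Ring A] [Algebra ℂ A]
    [AddCommGroup M] [Module ℂ M] [Module A M] [Module Aᵐᵒᵖ M]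
    [AddCommGroup N] [Module ℂ N] [Module A N] [Module Aᵐᵒᵖ N] where
  conv₁ : TensorOver A M N ≃ₗ[ℂ] A
  conv₂ : TensorOver A N M ≃ₗ[ℂ] A
  conv₁_left : ∀ (a : A) (m : M) (n : N),
    conv₁ (TensorOver.tmul A (a • m) n) = a * conv₁ (TensorOver.tmul A m n)
  conv₁_right : ∀ (m : M) (n : N) (a : A),
    conv₁ (TensorOver.tmul A m (op a • n)) = conv₁ (TensorOver.tmul A m n) * a
  conv₂_left : ∀ (a : A) (n : N) (m : M),
    conv₂ (TensorOver.tmul A (a • n) m) = a * conv₂ (TensorOver.tmul A n m)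
  conv₂_right : ∀ (n : N) (m : M) (a : A),
    conv₂ (TensorOver.tmul A n (op a • m)) = conv₂ (TensorOver.tmul A n m) * a
  assoc₁ : ∀ (m : M) (n : N) (m' : M),
    conv₁ (TensorOver.tmul A m n) • m' = op (conv₂ (TensorOver.tmul A n m')) • m
  assoc₂ : ∀ (n : N) (m : M) (n' : N),
    conv₂ (TensorOver.tmul A n m) • n' = op (conv₁ (TensorOver.tmul A m n')) • n

/-! ### The Laurent tensor algebra `L_A(M) = ⨁_{n ∈ ℤ} M^{⊗ n}` -/

section Laurent

/-- A bundled left `A`-module; used only to define the tensor powers by recursion. -/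
structure LeftMod (A : Type u) [Ring A] [Algebra ℂ A] where
  carrier : Type u
  [addCommGroup : AddCommGroup carrier]
  [moduleComplex : Module ℂ carrier]
  [module : Module A carrier]
  [tower : IsScalarTower ℂ A carrier]

attribute [instance] LeftMod.addCommGroup LeftMod.moduleComplex LeftMod.module LeftMod.tower

variable (A M N : Type u) [Ring A] [Algebra ℂ A]
  [AddCommGroup M] [Module ℂ M] [Module A M] [Module Aᵐᵒᵖ M]
  [IsScalarTower ℂ A M] [SMulCommClass A Aᵐᵒᵖ M]
  [AddCommGroup N] [Module ℂ N] [Module A N] [Module Aᵐᵒᵖ N]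
  [IsScalarTower ℂ A N] [SMulCommClass A Aᵐᵒᵖ N]

/-- The tensor powers `M^{⊗ 0} = A`, `M^{⊗ (k+1)} = M ⊗_A M^{⊗ k}`. -/
def tensorPow : ℕ → LeftMod A
  | 0 => ⟨A⟩
  | k + 1 => ⟨TensorOver A M (tensorPow k).carrier⟩

section Powers

variable {A M}

/-- `A = M^{⊗ 0}`. -/
def powUnit (a : A) : (tensorPow A M 0).carrier := a

/-- The bilinear map `(m, x) ↦ m ⊗ x` from `M × M^{⊗ k}` to `M^{⊗ (k+1)}`. -/
def powCons (k : ℕ) : M →ₗ[ℂ] (tensorPow A M k).carrier →ₗ[ℂ] (tensorPow A M (k + 1)).carrier :=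
  TensorOver.mk A M (tensorPow A M k).carrier

theorem smul_powUnit (a b : A) : a • (powUnit b : (tensorPow A M 0).carrier) = powUnit (a * b) :=
  rfl

theorem smul_powCons (k : ℕ) (a : A) (m : M) (x : (tensorPow A M k).carrier) :
    a • powCons k m x = powCons k (a • m) x :=
  TensorOver.smul_tmul a m x

theorem powCons_balanced (k : ℕ) (m : M) (a : A) (x : (tensorPow A M k).carrier) :
    powCons k (op a • m) x = powCons k m (a • x) :=
  TensorOver.tmul_balanced m a x

/-- A balanced bilinear map factors through `M^{⊗ (k+1)}`. -/
def powLift {Y : Type u} [AddCommGroup Y] [Module ℂ Y] (k : ℕ)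
    (f : M →ₗ[ℂ] (tensorPow A M k).carrier →ₗ[ℂ] Y)
    (hf : ∀ (m : M) (a : A) (x : (tensorPow A M k).carrier), f (op a • m) x = f m (a • x)) :
    (tensorPow A M (k + 1)).carrier →ₗ[ℂ] Y :=
  TensorOver.lift f hf

theorem powLift_powCons {Y : Type u} [AddCommGroup Y] [Module ℂ Y] (k : ℕ)
    (f : M →ₗ[ℂ] (tensorPow A M k).carrier →ₗ[ℂ] Y)
    (hf : ∀ (m : M) (a : A) (x : (tensorPow A M k).carrier), f (op a • m) x = f m (a • x))
    (m : M) (x : (tensorPow A M k).carrier) : powLift k f hf (powCons k m x) = f m x :=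
  TensorOver.lift_tmul f hf m x

theorem pow_induction {k : ℕ} {P : (tensorPow A M (k + 1)).carrier → Prop}
    (t : (tensorPow A M (k + 1)).carrier) (h0 : P 0) (ht : ∀ m x, P (powCons k m x))
    (ha : ∀ s t, P s → P t → P (s + t)) : P t :=
  TensorOver.induction_on (P := P) t h0 ht ha

end Powers

/-- `M^{⊗ n}` for an integer `n`: the tensor powers of `M` for `n ≥ 0` and those of `N = M⁻¹`
for `n < 0`. -/
def laurentPow : ℤ → LeftMod A
  | Int.ofNat k => tensorPow A M k
  | Int.negSucc k => tensorPow A N (k + 1)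

variable {A M N}

/-- The underlying space of the Laurent tensor algebra. -/
def LaurentTensorAlgebra (_I : InverseBimodules A M N) : Type u :=
  DirectSum ℤ fun n => (laurentPow A M N n).carrier

namespace LaurentTensorAlgebra

variable (I : InverseBimodules A M N)

instance : AddCommGroup (LaurentTensorAlgebra I) :=
  inferInstanceAs (AddCommGroup (DirectSum ℤ fun n => (laurentPow A M N n).carrier))

instance : Module ℂ (LaurentTensorAlgebra I) :=
  inferInstanceAs (Module ℂ (DirectSum ℤ fun n => (laurentPow A M N n).carrier))

instance : Module A (LaurentTensorAlgebra I) :=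
  inferInstanceAs (Module A (DirectSum ℤ fun n => (laurentPow A M N n).carrier))

instance : IsScalarTower ℂ A (LaurentTensorAlgebra I) :=
  inferInstanceAs (IsScalarTower ℂ A (DirectSum ℤ fun n => (laurentPow A M N n).carrier))

/-- The inclusion of `M^{⊗ k}`, `k ≥ 0`. -/
def embPos (k : ℕ) : (tensorPow A M k).carrier →ₗ[A] LaurentTensorAlgebra I :=
  DirectSum.lof A ℤ (fun n => (laurentPow A M N n).carrier) (Int.ofNat k)

/-- The inclusion of `N^{⊗ k} = M^{⊗ -k}`, `k ≥ 0`. -/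
def embNeg : (k : ℕ) → (tensorPow A N k).carrier →ₗ[A] LaurentTensorAlgebra I
  | 0 => DirectSum.lof A ℤ (fun n => (laurentPow A M N n).carrier) (Int.ofNat 0)
  | k + 1 => DirectSum.lof A ℤ (fun n => (laurentPow A M N n).carrier) (Int.negSucc k)

theorem embNeg_zero (a : A) : embNeg I 0 (powUnit a) = embPos I 0 (powUnit a) := rfl

/-- Complex linear maps out of the direct sum. -/
def elim {Y : Type u} [AddCommGroup Y] [Module ℂ Y]
    (f : (k : ℕ) → (tensorPow A M k).carrier →ₗ[ℂ] Y)
    (g : (k : ℕ) → (tensorPow A N (k + 1)).carrier →ₗ[ℂ] Y) : LaurentTensorAlgebra I →ₗ[ℂ] Y :=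
  DirectSum.toModule ℂ ℤ Y fun n =>
    match n with
    | Int.ofNat k => f k
    | Int.negSucc k => g k

section

variable {Y : Type u} [AddCommGroup Y] [Module ℂ Y]
    (f : (k : ℕ) → (tensorPow A M k).carrier →ₗ[ℂ] Y)
    (g : (k : ℕ) → (tensorPow A N (k + 1)).carrier →ₗ[ℂ] Y)

theorem elim_pos (k : ℕ) (x : (tensorPow A M k).carrier) : elim I f g (embPos I k x) = f k x :=
  DirectSum.toModule_lof (ι := ℤ) (M := fun n => (laurentPow A M N n).carrier) ℂ (Int.ofNat k) x

theorem elim_neg (k : ℕ) (x : (tensorPow A N (k + 1)).carrier) :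
    elim I f g (embNeg I (k + 1) x) = g k x :=
  DirectSum.toModule_lof (ι := ℤ) (M := fun n => (laurentPow A M N n).carrier) ℂ (Int.negSucc k) x

end

/-- It suffices to check an additive property on the unit component, and on elementary tensors. -/
theorem induction_on {P : LaurentTensorAlgebra I → Prop} (v : LaurentTensorAlgebra I)
    (hadd : ∀ v w, P v → P w → P (v + w))
    (h0 : ∀ a : A, P (embPos I 0 (powUnit a)))
    (hpos : ∀ (k : ℕ) (m : M) (x : (tensorPow A M k).carrier), P (embPos I k x) →
      P (embPos I (k + 1) (powCons k m x)))
    (hneg : ∀ (k : ℕ) (n : N) (x : (tensorPow A N k).carrier), P (embNeg I k x) →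
      P (embNeg I (k + 1) (powCons k n x))) : P v := by
  have hz : P 0 := (map_zero (embPos I 0)) ▸ h0 0
  have hp : ∀ (k : ℕ) (x : (tensorPow A M k).carrier), P (embPos I k x) := by
    intro k
    induction k with
    | zero => exact h0
    | succ k ih =>
      intro x
      induction x using pow_induction with
      | h0 => rwa [map_zero]
      | ht m x => exact hpos k m x (ih x)
      | ha s t hs ht => rw [map_add]; exact hadd _ _ hs ht
  have hn : ∀ (k : ℕ) (x : (tensorPow A N k).carrier), P (embNeg I k x) := by
    intro k
    induction k with
    | zero => exact h0
    | succ k ih =>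
      intro x
      induction x using pow_induction with
      | h0 => rwa [map_zero]
      | ht m x => exact hneg k m x (ih x)
      | ha s t hs ht => rw [map_add]; exact hadd _ _ hs ht
  refine DirectSum.induction_on (motive := P) v hz ?_ hadd
  rintro (k | k) x
  · exact hp k x
  · exact hn (k + 1) x

/-- The contraction `(m, n ⊗ x) ↦ c(m ⊗ n) x` from `M × N^{⊗ (k+1)}` to `N^{⊗ k}`, for a pairing
`c : M ⊗_A N → A`. -/
def contract {M N : Type u} [AddCommGroup M] [Module ℂ M] [Module Aᵐᵒᵖ M]
    [AddCommGroup N] [Module ℂ N] [Module A N] [Module Aᵐᵒᵖ N]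
    [IsScalarTower ℂ A N] [SMulCommClass A Aᵐᵒᵖ N]
    (c : TensorOver A M N →ₗ[ℂ] A)
    (hc : ∀ (m : M) (n : N) (a : A),
      c (TensorOver.tmul A m (op a • n)) = c (TensorOver.tmul A m n) * a) (k : ℕ) :
    M →ₗ[ℂ] (tensorPow A N (k + 1)).carrier →ₗ[ℂ] (tensorPow A N k).carrier :=
  LinearMap.flip <| powLift k
    (LinearMap.mk₂ ℂ
      (fun n x => ((Algebra.lsmul ℂ ℂ (tensorPow A N k).carrier).toLinearMap.flip x).comp
        (c.comp ((TensorOver.mk A M N).flip n)))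
      (fun n n' x => by ext; simp) (fun z n x => by ext; simp)
      (fun n x x' => by ext; simp) (fun z n x => by ext; simp))
    (fun n a x => by
      ext m
      change c (TensorOver.tmul A m (op a • n)) • x = c (TensorOver.tmul A m n) • a • x
      rw [hc, mul_smul])

theorem contract_powCons {M N : Type u} [AddCommGroup M] [Module ℂ M] [Module Aᵐᵒᵖ M]
    [AddCommGroup N] [Module ℂ N] [Module A N] [Module Aᵐᵒᵖ N]
    [IsScalarTower ℂ A N] [SMulCommClass A Aᵐᵒᵖ N]
    (c : TensorOver A M N →ₗ[ℂ] A)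
    (hc : ∀ (m : M) (n : N) (a : A),
      c (TensorOver.tmul A m (op a • n)) = c (TensorOver.tmul A m n) * a) (k : ℕ)
    (m : M) (n : N) (x : (tensorPow A N k).carrier) :
    contract c hc k m (powCons k n x) = c (TensorOver.tmul A m n) • x := by
  rw [contract, LinearMap.flip_apply, powLift_powCons]
  rfl

/-- Left multiplication by `m ∈ M` on `L_A(M)`: it sends `x ∈ M^{⊗ k}` to `m ⊗ x`, and
`n ⊗ x ∈ N^{⊗ (k+1)}` to `conv₁(m ⊗ n) x`. -/
def leftMulM : M →ₗ[ℂ] Module.End ℂ (LaurentTensorAlgebra I) :=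
  LinearMap.flip <| elim I
    (fun k => ((powCons k).compr₂ ((embPos I (k + 1)).restrictScalars ℂ)).flip)
    (fun k => ((contract I.conv₁.toLinearMap I.conv₁_right k).compr₂
      ((embNeg I k).restrictScalars ℂ)).flip)

/-- Left multiplication by `n ∈ N = M⁻¹` on `L_A(M)`: it sends `x ∈ N^{⊗ k}` to `n ⊗ x`, and
`m ⊗ x ∈ M^{⊗ (k+1)}` to `conv₂(n ⊗ m) x`. -/
def leftMulN : N →ₗ[ℂ] Module.End ℂ (LaurentTensorAlgebra I) :=
  LinearMap.flip <| elim I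
    (fun k => match k with
      | 0 => ((powCons 0).compr₂ ((embNeg I 1).restrictScalars ℂ)).flip
      | k + 1 => ((contract I.conv₂.toLinearMap I.conv₂_right k).compr₂
          ((embPos I k).restrictScalars ℂ)).flip)
    (fun k => ((powCons (k + 1)).compr₂ ((embNeg I (k + 2)).restrictScalars ℂ)).flip)

theorem leftMulM_pos (m : M) (k : ℕ) (x : (tensorPow A M k).carrier) :
    leftMulM I m (embPos I k x) = embPos I (k + 1) (powCons k m x) := by
  rw [leftMulM, LinearMap.flip_apply, elim_pos]
  rfl

theorem leftMulM_neg (m : M) (k : ℕ) (n : N) (x : (tensorPow A N k).carrier) :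
    leftMulM I m (embNeg I (k + 1) (powCons k n x)) =
      I.conv₁ (TensorOver.tmul A m n) • embNeg I k x := by
  rw [leftMulM, LinearMap.flip_apply, elim_neg, ← map_smul]
  exact congrArg (embNeg I k) (contract_powCons _ I.conv₁_right k m n x)

theorem leftMulN_neg (n : N) (k : ℕ) (x : (tensorPow A N k).carrier) :
    leftMulN I n (embNeg I k x) = embNeg I (k + 1) (powCons k n x) := by
  rw [leftMulN, LinearMap.flip_apply]
  cases k with
  | zero => exact LinearMap.congr_fun (elim_pos I _ _ 0 x) n
  | succ k => rw [elim_neg]; rfl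

theorem leftMulN_pos (n : N) (k : ℕ) (m : M) (x : (tensorPow A M k).carrier) :
    leftMulN I n (embPos I (k + 1) (powCons k m x)) =
      I.conv₂ (TensorOver.tmul A n m) • embPos I k x := by
  rw [leftMulN, LinearMap.flip_apply, elim_pos, ← map_smul]
  exact congrArg (embPos I k) (contract_powCons _ I.conv₂_right k n m x)

theorem leftMulM_smul (a : A) (m : M) (v : LaurentTensorAlgebra I) :
    leftMulM I (a • m) v = a • leftMulM I m v := by
  induction v using induction_on with
  | hadd v w hv hw => rw [map_add, map_add, hv, hw, smul_add]
  | h0 b => rw [leftMulM_pos, leftMulM_pos, ← map_smul, smul_powCons]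
  | hpos k m' x _ => rw [leftMulM_pos, leftMulM_pos, ← map_smul, smul_powCons]
  | hneg k n x _ => rw [leftMulM_neg, leftMulM_neg, I.conv₁_left, mul_smul]

theorem leftMulN_smul (a : A) (n : N) (v : LaurentTensorAlgebra I) :
    leftMulN I (a • n) v = a • leftMulN I n v := by
  induction v using induction_on with
  | hadd v w hv hw => rw [map_add, map_add, hv, hw, smul_add]
  | h0 b => rw [← embNeg_zero, leftMulN_neg, leftMulN_neg, ← map_smul, smul_powCons]
  | hpos k m x _ => rw [leftMulN_pos, leftMulN_pos, I.conv₂_left, mul_smul]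
  | hneg k n' x _ => rw [leftMulN_neg, leftMulN_neg, ← map_smul, smul_powCons]

theorem leftMulM_op_smul (m : M) (a : A) (v : LaurentTensorAlgebra I) :
    leftMulM I (op a • m) v = leftMulM I m (a • v) := by
  induction v using induction_on with
  | hadd v w hv hw => rw [map_add, hv, hw, smul_add, map_add]
  | h0 b => rw [← map_smul, leftMulM_pos, leftMulM_pos, powCons_balanced]
  | hpos k m' x _ => rw [← map_smul, leftMulM_pos, leftMulM_pos, powCons_balanced]
  | hneg k n x _ =>
    rw [← map_smul, smul_powCons, leftMulM_neg, leftMulM_neg, TensorOver.tmul_balanced]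

theorem leftMulN_op_smul (n : N) (a : A) (v : LaurentTensorAlgebra I) :
    leftMulN I (op a • n) v = leftMulN I n (a • v) := by
  induction v using induction_on with
  | hadd v w hv hw => rw [map_add, hv, hw, smul_add, map_add]
  | h0 b => rw [← embNeg_zero, ← map_smul, leftMulN_neg, leftMulN_neg, powCons_balanced]
  | hpos k m x _ =>
    rw [← map_smul, smul_powCons, leftMulN_pos, leftMulN_pos, TensorOver.tmul_balanced]
  | hneg k n' x _ => rw [← map_smul, leftMulN_neg, leftMulN_neg, powCons_balanced]

theorem leftMulM_leftMulN (m : M) (n : N) (v : LaurentTensorAlgebra I) :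
    leftMulM I m (leftMulN I n v) = I.conv₁ (TensorOver.tmul A m n) • v := by
  induction v using induction_on with
  | hadd v w hv hw => rw [map_add, map_add, hv, hw, smul_add]
  | h0 b => rw [← embNeg_zero, leftMulN_neg, leftMulM_neg]
  | hpos k m' x _ =>
    rw [leftMulN_pos, ← leftMulM_op_smul, ← I.assoc₁, leftMulM_smul, leftMulM_pos]
  | hneg k n' x _ => rw [leftMulN_neg, leftMulM_neg]

theorem leftMulN_leftMulM (n : N) (m : M) (v : LaurentTensorAlgebra I) :
    leftMulN I n (leftMulM I m v) = I.conv₂ (TensorOver.tmul A n m) • v := by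
  induction v using induction_on with
  | hadd v w hv hw => rw [map_add, map_add, hv, hw, smul_add]
  | h0 b => rw [leftMulM_pos, leftMulN_pos]
  | hpos k m' x _ => rw [leftMulM_pos, leftMulN_pos]
  | hneg k n' x _ =>
    rw [leftMulM_neg, ← leftMulN_op_smul, ← I.assoc₂, leftMulN_smul, leftMulN_neg]

theorem extendMul_balanced {P : Type u} [AddCommGroup P] [Module ℂ P] [Module A P] [Module Aᵐᵒᵖ P]
    [IsScalarTower ℂ A P] [SMulCommClass A Aᵐᵒᵖ P]
    (l : P →ₗ[ℂ] Module.End ℂ (LaurentTensorAlgebra I))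
    (hr : ∀ (p : P) (a : A) (v : LaurentTensorAlgebra I), l (op a • p) v = l p (a • v)) (k : ℕ)
    (f : (tensorPow A P k).carrier →ₗ[A] Module.End ℂ (LaurentTensorAlgebra I))
    (p : P) (a : A) (x : (tensorPow A P k).carrier) :
    ((LinearMap.mul ℂ (Module.End ℂ (LaurentTensorAlgebra I))).comp l).compl₂
      (f.restrictScalars ℂ) (op a • p) x =
    ((LinearMap.mul ℂ (Module.End ℂ (LaurentTensorAlgebra I))).comp l).compl₂
      (f.restrictScalars ℂ) p (a • x) := by
  ext v
  change l (op a • p) (f x v) = l p (f (a • x) v)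
  rw [hr, f.map_smul]
  rfl

/-- Extend a left multiplication from `P^{⊗ k}` to `P^{⊗ (k+1)}` by
`(p ⊗ x) · v = p · (x · v)`. -/
def extendMul {P : Type u} [AddCommGroup P] [Module ℂ P] [Module A P] [Module Aᵐᵒᵖ P]
    [IsScalarTower ℂ A P] [SMulCommClass A Aᵐᵒᵖ P]
    (l : P →ₗ[ℂ] Module.End ℂ (LaurentTensorAlgebra I))
    (hl : ∀ (a : A) (p : P) (v : LaurentTensorAlgebra I), l (a • p) v = a • l p v)
    (hr : ∀ (p : P) (a : A) (v : LaurentTensorAlgebra I), l (op a • p) v = l p (a • v)) (k : ℕ)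
    (f : (tensorPow A P k).carrier →ₗ[A] Module.End ℂ (LaurentTensorAlgebra I)) :
    (tensorPow A P (k + 1)).carrier →ₗ[A] Module.End ℂ (LaurentTensorAlgebra I) where
  toFun := powLift k
    (((LinearMap.mul ℂ (Module.End ℂ (LaurentTensorAlgebra I))).comp l).compl₂
      (f.restrictScalars ℂ))
    (extendMul_balanced I l hr k f)
  map_add' := map_add _
  map_smul' a t := by
    induction t using pow_induction with
    | h0 => simp
    | ht p x =>
      rw [smul_powCons, powLift_powCons, powLift_powCons]
      ext v
      exact hl a p (f x v)
    | ha s t hs ht => rw [smul_add, map_add, hs, ht, map_add, smul_add]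

theorem extendMul_powCons {P : Type u} [AddCommGroup P] [Module ℂ P] [Module A P] [Module Aᵐᵒᵖ P]
    [IsScalarTower ℂ A P] [SMulCommClass A Aᵐᵒᵖ P]
    (l : P →ₗ[ℂ] Module.End ℂ (LaurentTensorAlgebra I))
    (hl : ∀ (a : A) (p : P) (v : LaurentTensorAlgebra I), l (a • p) v = a • l p v)
    (hr : ∀ (p : P) (a : A) (v : LaurentTensorAlgebra I), l (op a • p) v = l p (a • v)) (k : ℕ)
    (f : (tensorPow A P k).carrier →ₗ[A] Module.End ℂ (LaurentTensorAlgebra I))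
    (p : P) (x : (tensorPow A P k).carrier) (v : LaurentTensorAlgebra I) :
    extendMul I l hl hr k f (powCons k p x) v = l p (f x v) :=
  LinearMap.congr_fun (TensorOver.lift_tmul
    (((LinearMap.mul ℂ (Module.End ℂ (LaurentTensorAlgebra I))).comp l).compl₂
      (f.restrictScalars ℂ)) (extendMul_balanced I l hr k f) p x) v

/-- Left multiplication by elements of `A = P^{⊗ 0}`. -/
def unitMul (P : Type u) [AddCommGroup P] [Module ℂ P] [Module A P] [Module Aᵐᵒᵖ P]
    [IsScalarTower ℂ A P] [SMulCommClass A Aᵐᵒᵖ P] :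
    (tensorPow A P 0).carrier →ₗ[A] Module.End ℂ (LaurentTensorAlgebra I) :=
  LinearMap.toSpanSingleton A (Module.End ℂ (LaurentTensorAlgebra I)) LinearMap.id

/-- Left multiplication by elements of `M^{⊗ k}`. -/
def mulPos : (k : ℕ) → (tensorPow A M k).carrier →ₗ[A] Module.End ℂ (LaurentTensorAlgebra I)
  | 0 => unitMul I M
  | k + 1 => extendMul I (leftMulM I) (leftMulM_smul I) (leftMulM_op_smul I) k (mulPos k)

/-- Left multiplication by elements of `N^{⊗ k}`. -/
def mulNeg : (k : ℕ) → (tensorPow A N k).carrier →ₗ[A] Module.End ℂ (LaurentTensorAlgebra I)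
  | 0 => unitMul I N
  | k + 1 => extendMul I (leftMulN I) (leftMulN_smul I) (leftMulN_op_smul I) k (mulNeg k)

/-- The multiplication of `L_A(M)`.  It is determined by `a · v = a v` for `a ∈ A = M^{⊗ 0}`,
`(m ⊗ x) · v = m · (x · v)` and `(n ⊗ x) · v = n · (x · v)`, where `m · v` and `n · v` are
`leftMulM` and `leftMulN`. -/
def mulL : LaurentTensorAlgebra I →ₗ[ℂ] Module.End ℂ (LaurentTensorAlgebra I) :=
  elim I (fun k => (mulPos I k).restrictScalars ℂ) (fun k => (mulNeg I (k + 1)).restrictScalars ℂ)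

theorem mulL_embPos (k : ℕ) (x : (tensorPow A M k).carrier) :
    mulL I (embPos I k x) = mulPos I k x :=
  elim_pos I _ _ k x

theorem mulL_embNeg (k : ℕ) (x : (tensorPow A N k).carrier) :
    mulL I (embNeg I k x) = mulNeg I k x := by
  cases k with
  | zero => exact elim_pos I _ _ 0 x
  | succ k => exact elim_neg I _ _ k x

theorem mulL_unit (a : A) (v : LaurentTensorAlgebra I) :
    mulL I (embPos I 0 (powUnit a)) v = a • v := by
  rw [mulL_embPos]
  rfl

theorem mulL_pos (k : ℕ) (m : M) (x : (tensorPow A M k).carrier) (v : LaurentTensorAlgebra I) :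
    mulL I (embPos I (k + 1) (powCons k m x)) v = leftMulM I m (mulL I (embPos I k x) v) := by
  rw [mulL_embPos, mulL_embPos]
  exact extendMul_powCons I _ _ _ k _ m x v

theorem mulL_neg (k : ℕ) (n : N) (x : (tensorPow A N k).carrier) (v : LaurentTensorAlgebra I) :
    mulL I (embNeg I (k + 1) (powCons k n x)) v = leftMulN I n (mulL I (embNeg I k x) v) := by
  rw [mulL_embNeg, mulL_embNeg]
  exact extendMul_powCons I _ _ _ k _ n x v

theorem mulL_smul (a : A) (v w : LaurentTensorAlgebra I) : mulL I (a • v) w = a • mulL I v w := by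
  induction v using induction_on with
  | hadd v v' hv hv' =>
    rw [smul_add, map_add, LinearMap.add_apply, hv, hv', map_add, LinearMap.add_apply, smul_add]
  | h0 b => rw [← map_smul, smul_powUnit, mulL_unit, mulL_unit, mul_smul]
  | hpos k m x _ => rw [← map_smul, smul_powCons, mulL_pos, mulL_pos, leftMulM_smul]
  | hneg k n x _ => rw [← map_smul, smul_powCons, mulL_neg, mulL_neg, leftMulN_smul]

theorem mulL_leftMulM (m : M) (v w : LaurentTensorAlgebra I) :
    mulL I (leftMulM I m v) w = leftMulM I m (mulL I v w) := by
  induction v using induction_on with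
  | hadd v v' hv hv' => simp only [map_add, LinearMap.add_apply, hv, hv']
  | h0 b => rw [leftMulM_pos, mulL_pos]
  | hpos k m' x _ => rw [leftMulM_pos, mulL_pos]
  | hneg k n x _ => rw [leftMulM_neg, mulL_neg, leftMulM_leftMulN, mulL_smul]

theorem mulL_leftMulN (n : N) (v w : LaurentTensorAlgebra I) :
    mulL I (leftMulN I n v) w = leftMulN I n (mulL I v w) := by
  induction v using induction_on with
  | hadd v v' hv hv' => simp only [map_add, LinearMap.add_apply, hv, hv']
  | h0 b => rw [← embNeg_zero, leftMulN_neg, mulL_neg]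
  | hpos k m x _ => rw [leftMulN_pos, mulL_pos, leftMulN_leftMulM, mulL_smul]
  | hneg k n' x _ => rw [leftMulN_neg, mulL_neg]

theorem mulL_assoc (u v w : LaurentTensorAlgebra I) :
    mulL I (mulL I u v) w = mulL I u (mulL I v w) := by
  induction u using induction_on with
  | hadd u u' hu hu' => simp only [map_add, LinearMap.add_apply, hu, hu']
  | h0 b => rw [mulL_unit, mulL_unit, mulL_smul]
  | hpos k m x ih => rw [mulL_pos, mulL_pos, mulL_leftMulM, ih]
  | hneg k n x ih => rw [mulL_neg, mulL_neg, mulL_leftMulN, ih]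

theorem mulL_one (u : LaurentTensorAlgebra I) : mulL I u (embPos I 0 (powUnit 1)) = u := by
  induction u using induction_on with
  | hadd u u' hu hu' => rw [map_add, LinearMap.add_apply, hu, hu']
  | h0 b => rw [mulL_unit, ← map_smul, smul_powUnit, mul_one]
  | hpos k m x ih => rw [mulL_pos, ih, leftMulM_pos]
  | hneg k n x ih => rw [mulL_neg, ih, leftMulN_neg]

/-- The Laurent tensor algebra as a ring. -/
instance : Ring (LaurentTensorAlgebra I) where
  __ := (inferInstance : AddCommGroup (LaurentTensorAlgebra I))
  mul v w := mulL I v w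
  one := embPos I 0 (powUnit 1)
  left_distrib u v w := map_add (mulL I u) v w
  right_distrib u v w := LinearMap.congr_fun (map_add (mulL I) u v) w
  zero_mul v := LinearMap.congr_fun (map_zero (mulL I)) v
  mul_zero v := map_zero (mulL I v)
  mul_assoc := mulL_assoc I
  one_mul v := (mulL_unit I 1 v).trans (one_smul A v)
  mul_one := mulL_one I

/-- The Laurent tensor algebra as a complex algebra. -/
instance : Algebra ℂ (LaurentTensorAlgebra I) :=
  Algebra.ofModule (fun c v w => LinearMap.congr_fun (map_smul (mulL I) c v) w)
    (fun c v w => map_smul (mulL I v) c w)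

/-- The tautological inclusion of `A = M^{⊗ 0}`. -/
def inclA (a : A) : LaurentTensorAlgebra I := embPos I 0 (powUnit a)

/-- The tautological inclusion of `M`, identified with `M^{⊗ 1} = M ⊗_A A` by `m ↦ m ⊗ 1`. -/
def inclM (m : M) : LaurentTensorAlgebra I := embPos I 1 (powCons 0 m (powUnit 1))

/-- The tautological inclusion of `N = M⁻¹`, identified with `N ⊗_A A` by `n ↦ n ⊗ 1`. -/
def inclN (n : N) : LaurentTensorAlgebra I := embNeg I 1 (powCons 0 n (powUnit 1))

end LaurentTensorAlgebra

end Laurent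

/-! ### Locally convex algebras and bimodules -/

/-- An Arens--Michael algebra: a complete (Hausdorff) algebra whose topology is defined by a family
of submultiplicative seminorms. -/
class ArensMichaelAlgebra (B : Type u) [Ring B] [Algebra ℂ B] [UniformSpace B] : Prop
    extends IsUniformAddGroup B, CompleteSpace B, T2Space B where
  mconvex : ∃ S : Set (Seminorm ℂ B), (∀ p ∈ S, ∀ x y : B, p (x * y) ≤ p x * p y) ∧
    WithSeminorms (fun p : S => (p : Seminorm ℂ B))

/-- The topological part of the notion of an `R`-`⊗̂`-bimodule: a complete (Hausdorff) locally
convex space with jointly continuous left and right actions. -/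
class HatBimodule (R E : Type u) [Ring R] [TopologicalSpace R] [AddCommGroup E] [Module ℂ E]
    [Module R E] [Module Rᵐᵒᵖ E] [UniformSpace E] : Prop
    extends IsUniformAddGroup E, CompleteSpace E, T2Space E, PolynormableSpace ℂ E where
  continuous_left : ContinuousSMul R E
  continuous_right : ContinuousSMul Rᵐᵒᵖ E

/-- A Fréchet space: a complete metrizable locally convex space. -/
structure IsFrechetSpace (E : Type u) [AddCommGroup E] [Module ℂ E] [UniformSpace E] : Prop where
  isUniformAddGroup : IsUniformAddGroup E
  complete : CompleteSpace E
  metrizable : TopologicalSpace.MetrizableSpace E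
  locallyConvex : PolynormableSpace ℂ E

/-! ### The completed projective tensor product over an algebra -/

section CompletedTensor

variable (A M N : Type u) [Ring A]
  [AddCommGroup M] [Module ℂ M] [Module Aᵐᵒᵖ M] [TopologicalSpace M]
  [AddCommGroup N] [Module ℂ N] [Module A N] [TopologicalSpace N]

/-- The seminorms `p` on `M ⊗_A N` for which `(m, n) ↦ p (m ⊗ n)` is jointly continuous. -/
def projectiveSeminorms :
    SeminormFamily ℂ (TensorOver A M N)
      {p : Seminorm ℂ (TensorOver A M N) //
        Continuous fun q : M × N => p (TensorOver.tmul A q.1 q.2)} :=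
  fun p => p.1

/-- The projective topology (uniformity) on `M ⊗_A N`: the finest locally convex one for which
`M × N → M ⊗_A N` is jointly continuous. -/
instance projectiveUniformSpace : UniformSpace (TensorOver A M N) :=
  ⨅ p, (projectiveSeminorms A M N p).toSeminormedAddCommGroup.toUniformSpace

instance : IsUniformAddGroup (TensorOver A M N) :=
  isUniformAddGroup_iInf fun p =>
    (projectiveSeminorms A M N p).toSeminormedAddCommGroup.to_isUniformAddGroup

theorem projective_withSeminorms : WithSeminorms (projectiveSeminorms A M N) :=
  (projectiveSeminorms A M N).withSeminorms_iff_uniformSpace_eq_iInf.2 rfl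

instance : UniformContinuousConstSMul ℂ (TensorOver A M N) :=
  have := (projective_withSeminorms A M N).continuousSMul
  uniformContinuousConstSMul_of_continuousConstSMul _ _

/-- The completed projective tensor product `M ⊗̂_A N`: the Hausdorff completion of `M ⊗_A N` in the
projective topology. -/
abbrev CompletedTensorOver : Type u := UniformSpace.Completion (TensorOver A M N)

variable {M N} in
/-- The elementary tensor `m ⊗ n` in `M ⊗̂_A N`. -/
def hatTmul (m : M) (n : N) : CompletedTensorOver A M N :=
  ((TensorOver.tmul A m n : TensorOver A M N) : UniformSpace.Completion (TensorOver A M N))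

end CompletedTensor

/-- The data making `M` and `N` topologically inverse `R`-`⊗̂`-bimodules: topological bimodule
isomorphisms `M ⊗̂_R N ≃ R` and `N ⊗̂_R M ≃ R` making the associativity squares on `M ⊗̂_R N ⊗̂_R M`
and `N ⊗̂_R M ⊗̂_R N` commute.  Left and right linearity and the squares, being equalities of
continuous linear maps, are spelled out on elementary tensors, which have dense span. -/
structure TopInverseBimodules (R M N : Type u) [Ring R] [Algebra ℂ R] [TopologicalSpace R]
    [AddCommGroup M] [Module ℂ M] [Module R M] [Module Rᵐᵒᵖ M] [TopologicalSpace M]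
    [AddCommGroup N] [Module ℂ N] [Module R N] [Module Rᵐᵒᵖ N] [TopologicalSpace N] where
  conv₁ : CompletedTensorOver R M N ≃L[ℂ] R
  conv₂ : CompletedTensorOver R N M ≃L[ℂ] R
  conv₁_left : ∀ (a : R) (m : M) (n : N), conv₁ (hatTmul R (a • m) n) = a * conv₁ (hatTmul R m n)
  conv₁_right : ∀ (m : M) (n : N) (a : R),
    conv₁ (hatTmul R m (op a • n)) = conv₁ (hatTmul R m n) * a
  conv₂_left : ∀ (a : R) (n : N) (m : M), conv₂ (hatTmul R (a • n) m) = a * conv₂ (hatTmul R n m)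
  conv₂_right : ∀ (n : N) (m : M) (a : R),
    conv₂ (hatTmul R n (op a • m)) = conv₂ (hatTmul R n m) * a
  assoc₁ : ∀ (m : M) (n : N) (m' : M),
    conv₁ (hatTmul R m n) • m' = op (conv₂ (hatTmul R n m')) • m
  assoc₂ : ∀ (n : N) (m : M) (n' : N),
    conv₂ (hatTmul R n m) • n' = op (conv₁ (hatTmul R m n')) • n

/-! ### Arens--Michael envelopes -/

/-- `(B, i)` is an Arens--Michael envelope of the algebra `A`. -/
structure IsArensMichaelEnvelope {A B : Type u} [Ring A] [Algebra ℂ A] [Ring B] [Algebra ℂ B]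
    [UniformSpace B] (i : A →ₐ[ℂ] B) : Prop where
  arensMichael : ArensMichaelAlgebra B
  universal : ∀ (C : Type u) [Ring C] [Algebra ℂ C] [UniformSpace C] [ArensMichaelAlgebra C]
    (φ : A →ₐ[ℂ] C), ∃! ψ : B →A[ℂ] C, ∀ a, ψ (i a) = φ a

/-- The complex linear map `f : M → X` from an `A`-bimodule to a `B`-bimodule is a homomorphism of
`A`-bimodules, where `A` acts on `X` through the algebra homomorphism `i : A → B`. -/
def IsBimoduleHom {A B M X : Type u} [Ring A] [Ring B] [AddCommGroup M] [Module ℂ M] [Module A M]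
    [Module Aᵐᵒᵖ M] [AddCommGroup X] [Module ℂ X] [Module B X] [Module Bᵐᵒᵖ X]
    (i : A → B) (f : M →ₗ[ℂ] X) : Prop :=
  (∀ a m, f (a • m) = i a • f m) ∧ ∀ a m, f (op a • m) = op (i a) • f m

/-- `(E, j)` is an Arens--Michael envelope of the `A`-bimodule `M`, where `(B, i)` is an
Arens--Michael envelope of `A`. -/
structure IsBimoduleEnvelope {A B M E : Type u} [Ring A] [Algebra ℂ A] [Ring B] [Algebra ℂ B]
    [UniformSpace B] [AddCommGroup M] [Module ℂ M] [Module A M] [Module Aᵐᵒᵖ M]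
    [AddCommGroup E] [Module ℂ E] [Module B E] [Module Bᵐᵒᵖ E] [UniformSpace E]
    (i : A →ₐ[ℂ] B) (j : M →ₗ[ℂ] E) : Prop where
  hatBimodule : HatBimodule B E
  isBimoduleHom : IsBimoduleHom i j
  universal : ∀ (X : Type u) [AddCommGroup X] [Module ℂ X] [Module B X] [Module Bᵐᵒᵖ X]
    [IsScalarTower ℂ B X] [IsScalarTower ℂ Bᵐᵒᵖ X] [SMulCommClass B Bᵐᵒᵖ X] [UniformSpace X]
    [HatBimodule B X] (f : M →ₗ[ℂ] X), IsBimoduleHom i f →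
    ∃! g : E →L[ℂ] X, IsBimoduleHom (id : B → B) (g : E →ₗ[ℂ] X) ∧ ∀ m, g (j m) = f m

/-! ### Topological Laurent tensor algebras -/

section TopLaurent

variable {R M N : Type u} [Ring R] [Algebra ℂ R] [TopologicalSpace R]
  [AddCommGroup M] [Module ℂ M] [Module R M] [Module Rᵐᵒᵖ M] [TopologicalSpace M]
  [AddCommGroup N] [Module ℂ N] [Module R N] [Module Rᵐᵒᵖ N] [TopologicalSpace N]

/-- A topologically compatible triple `(θ, α, β, B)`: `α` and `β` are bimodule homomorphisms for
the `R`-bimodule structure of `B` given by `θ`, and `θ ∘ conv₁ = m ∘ (α ⊗̂ β)`,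
`θ ∘ conv₂ = m ∘ (β ⊗̂ α)`; these equalities of continuous linear maps are stated on elementary
tensors, which have dense span. -/
structure IsTopCompatible (J : TopInverseBimodules R M N) {B : Type u} [Ring B] [Algebra ℂ B]
    [TopologicalSpace B] (θ : R →A[ℂ] B) (α : M →L[ℂ] B) (β : N →L[ℂ] B) : Prop where
  homM : IsBimoduleHom θ (α : M →ₗ[ℂ] B)
  homN : IsBimoduleHom θ (β : N →ₗ[ℂ] B)
  comp₁ : ∀ (m : M) (n : N), θ (J.conv₁ (hatTmul R m n)) = α m * β n
  comp₂ : ∀ (n : N) (m : M), θ (J.conv₂ (hatTmul R n m)) = β n * α m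

/-- `(θ, α, β, L)` is a topological (analytic) Laurent tensor algebra `L̂_R(M)`: a universal
topologically compatible triple in an Arens--Michael algebra. -/
structure IsTopLaurentTensorAlgebra (J : TopInverseBimodules R M N) {L : Type u} [Ring L]
    [Algebra ℂ L] [UniformSpace L] (θ : R →A[ℂ] L) (α : M →L[ℂ] L) (β : N →L[ℂ] L) : Prop where
  arensMichael : ArensMichaelAlgebra L
  compatible : IsTopCompatible J θ α β
  universal : ∀ (B : Type u) [Ring B] [Algebra ℂ B] [UniformSpace B] [ArensMichaelAlgebra B]
    (θ' : R →A[ℂ] B) (α' : M →L[ℂ] B) (β' : N →L[ℂ] B), IsTopCompatible J θ' α' β' →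
    ∃! f : L →A[ℂ] B, (∀ r, f (θ r) = θ' r) ∧ (∀ m, f (α m) = α' m) ∧ ∀ n, f (β n) = β' n

end TopLaurent

end LaurentAM

open LaurentAM

/-! Algebraic and topological Laurent tensor algebras represent the same kind of functor, and the
two functors agree on Arens–Michael algebras. Algebra homomorphisms `L_A(M) → C` are the compatible
triples `(φ, f, g)`: a homomorphism on `A` and bimodule maps on `M` and `M⁻¹` over it that turn the
two convolutions into products (`exists_algHom`, `algHom_ext`). Continuous homomorphisms from the
topological Laurent algebra are, by initiality, the topologically compatible triples on the
envelopes.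

For `C` an Arens–Michael algebra, restriction along the envelope maps identifies the two sets of
triples. In one direction `φ` extends to `ψ` on `Ahat`; through `ψ` the algebra `C` becomes an
`Ahat`-`⊗̂`-bimodule, so `f` and `g` extend to the bimodule envelopes
(`IsBimoduleEnvelope.exists_extension`). The convolution relations of the extensions hold on the
images of `M × N` and `N × M`; both sides are jointly continuous and these images are dense, so the
relations hold everywhere. Density also shows that the extended triple is determined by the original
one.

Density of an object in its envelope is formal: the closure of the image is again an admissible
target, so the envelope map factors through it, and uniqueness forces the factorization followed by
the inclusion to be the identity. -/

namespace LaurentAM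

namespace LaurentTensorAlgebra

/-! ### Universal property of the algebraic Laurent tensor algebra -/

section UniversalProperty

variable {A M N C : Type u} [Ring A] [Algebra ℂ A]
  [AddCommGroup M] [Module ℂ M] [Module A M] [Module Aᵐᵒᵖ M]
  [IsScalarTower ℂ A M] [SMulCommClass A Aᵐᵒᵖ M]
  [AddCommGroup N] [Module ℂ N] [Module A N] [Module Aᵐᵒᵖ N]
  [IsScalarTower ℂ A N] [SMulCommClass A Aᵐᵒᵖ N]
  [Ring C] [Algebra ℂ C]

/-- The multiplicative extension `p₁ ⊗ ⋯ ⊗ pₖ ⊗ a ↦ f p₁ ⋯ f pₖ φ(a)` of a bimodule map `f` to the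
tensor powers, together with its left linearity. -/
def powMap (φ : A →ₐ[ℂ] C) (f : M →ₗ[ℂ] C) (hl : ∀ a m, f (a • m) = φ a * f m)
    (hr : ∀ a m, f (op a • m) = f m * φ a) : (k : ℕ) →
    {g : (tensorPow A M k).carrier →ₗ[ℂ] C // ∀ (a : A) x, g (a • x) = φ a * g x}
  | 0 => ⟨φ.toLinearMap, fun a x => map_mul φ a x⟩
  -- Left linearity in degree `k` is what makes the map in degree `k + 1` balanced: `f(ma) g(x) =
  -- f(m) φ(a) g(x) = f(m) g(ax)`. Hence the recursion carries the map and its linearity together.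
  | k + 1 => ⟨powLift k (((LinearMap.mul ℂ C).comp f).compl₂ (powMap φ f hl hr k).1) (by
      intro m a x
      change f (op a • m) * (powMap φ f hl hr k).1 x = f m * (powMap φ f hl hr k).1 (a • x)
      rw [hr, (powMap φ f hl hr k).2, mul_assoc]), by
    intro a x
    induction x using pow_induction with
    | h0 => simp
    | ht m x =>
      rw [smul_powCons, powLift_powCons, powLift_powCons]
      change f (a • m) * (powMap φ f hl hr k).1 x = φ a * (f m * (powMap φ f hl hr k).1 x)
      rw [hl, mul_assoc]
    | ha s t hs ht => rw [smul_add, map_add, hs, ht, map_add, mul_add]⟩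

theorem powMap_zero (φ : A →ₐ[ℂ] C) (f : M →ₗ[ℂ] C) (hl : ∀ a m, f (a • m) = φ a * f m)
    (hr : ∀ a m, f (op a • m) = f m * φ a) (a : A) :
    (powMap φ f hl hr 0).1 (powUnit a) = φ a := rfl

theorem powMap_powCons (φ : A →ₐ[ℂ] C) (f : M →ₗ[ℂ] C) (hl : ∀ a m, f (a • m) = φ a * f m)
    (hr : ∀ a m, f (op a • m) = f m * φ a) (k : ℕ) (m : M) (x : (tensorPow A M k).carrier) :
    (powMap φ f hl hr (k + 1)).1 (powCons k m x) = f m * (powMap φ f hl hr k).1 x :=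
  powLift_powCons k (((LinearMap.mul ℂ C).comp f).compl₂ (powMap φ f hl hr k).1) (fun m a x => by
    change f (op a • m) * (powMap φ f hl hr k).1 x = f m * (powMap φ f hl hr k).1 (a • x)
    rw [hr, (powMap φ f hl hr k).2, mul_assoc]) m x

variable (I : InverseBimodules A M N)

theorem mul_def (v w : LaurentTensorAlgebra I) : v * w = mulL I v w := rfl

theorem inclA_mul (a : A) (v : LaurentTensorAlgebra I) : inclA I a * v = a • v :=
  mulL_unit I a v

theorem inclM_mul (m : M) (v : LaurentTensorAlgebra I) : inclM I m * v = leftMulM I m v := by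
  rw [mul_def, inclM, mulL_pos, mulL_unit, one_smul]

theorem inclN_mul (n : N) (v : LaurentTensorAlgebra I) : inclN I n * v = leftMulN I n v := by
  rw [mul_def, inclN, mulL_neg, embNeg_zero, mulL_unit, one_smul]

/-- The identities from here to `inclN_mul_inclM` say that the three inclusions form a compatible
triple; composing with a homomorphism out of `L_A(M)` then gives a compatible triple in its target.
-/
theorem inclA_mul_inclM (a : A) (m : M) : inclA I a * inclM I m = inclM I (a • m) := by
  rw [inclA_mul, inclM, ← map_smul, smul_powCons, inclM]

theorem inclA_mul_inclN (a : A) (n : N) : inclA I a * inclN I n = inclN I (a • n) := by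
  rw [inclA_mul, inclN, ← map_smul, smul_powCons, inclN]

theorem inclM_mul_inclA (a : A) (m : M) : inclM I m * inclA I a = inclM I (op a • m) := by
  rw [inclM_mul, inclA, leftMulM_pos, inclM, powCons_balanced, smul_powUnit, mul_one]

theorem inclN_mul_inclA (a : A) (n : N) : inclN I n * inclA I a = inclN I (op a • n) := by
  rw [inclN_mul, inclA, ← embNeg_zero, leftMulN_neg, inclN, powCons_balanced, smul_powUnit, mul_one]

theorem inclM_mul_inclN (m : M) (n : N) :
    inclM I m * inclN I n = inclA I (I.conv₁ (TensorOver.tmul A m n)) := by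
  rw [inclM_mul, inclN, leftMulM_neg, embNeg_zero, ← map_smul, smul_powUnit, mul_one, inclA]

theorem inclN_mul_inclM (n : N) (m : M) :
    inclN I n * inclM I m = inclA I (I.conv₂ (TensorOver.tmul A n m)) := by
  rw [inclN_mul, inclM, leftMulN_pos, ← map_smul, smul_powUnit, mul_one, inclA]

/-- The inclusion of `A` as an algebra homomorphism. -/
def inclAHom : A →ₐ[ℂ] LaurentTensorAlgebra I :=
  AlgHom.ofLinearMap ((embPos I 0).restrictScalars ℂ : A →ₗ[ℂ] LaurentTensorAlgebra I) rfl
    fun a b => by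
      change inclA I (a * b) = inclA I a * inclA I b
      rw [inclA_mul, inclA, inclA, ← map_smul, smul_powUnit]

@[simp] theorem inclAHom_apply (a : A) : inclAHom I a = inclA I a := rfl

/-- The inclusion of `M` as a linear map. -/
def inclMLin : M →ₗ[ℂ] LaurentTensorAlgebra I :=
  ((embPos I 1).restrictScalars ℂ).comp ((powCons 0).flip (powUnit 1))

@[simp] theorem inclMLin_apply (m : M) : inclMLin I m = inclM I m := rfl

/-- The inclusion of `N` as a linear map. -/
def inclNLin : N →ₗ[ℂ] LaurentTensorAlgebra I :=
  ((embNeg I 1).restrictScalars ℂ).comp ((powCons 0).flip (powUnit 1))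

@[simp] theorem inclNLin_apply (n : N) : inclNLin I n = inclN I n := rfl

variable {I} in
/-- Algebra homomorphisms out of the Laurent tensor algebra agree if they agree on `A`, `M`, `N`. -/
theorem algHom_ext {f g : LaurentTensorAlgebra I →ₐ[ℂ] C}
    (hA : ∀ a, f (inclA I a) = g (inclA I a)) (hM : ∀ m, f (inclM I m) = g (inclM I m))
    (hN : ∀ n, f (inclN I n) = g (inclN I n)) : f = g := by
  ext v
  induction v using induction_on with
  | hadd v w hv hw => rw [map_add, map_add, hv, hw]
  | h0 a => exact hA a
  -- The tensor `m ⊗ x` is the product of `m` and `x` in `L_A(M)`, so agreement spreads from `A`,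
  -- `M`, `N` to all degrees.
  | hpos k m x ih => rw [← leftMulM_pos, ← inclM_mul, map_mul, map_mul, hM, ih]
  | hneg k n x ih => rw [← leftMulN_neg, ← inclN_mul, map_mul, map_mul, hN, ih]

/-- The universal property of the Laurent tensor algebra. -/
theorem exists_algHom (φ : A →ₐ[ℂ] C) (f : M →ₗ[ℂ] C) (g : N →ₗ[ℂ] C)
    (fl : ∀ a m, f (a • m) = φ a * f m) (fr : ∀ a m, f (op a • m) = f m * φ a)
    (gl : ∀ a n, g (a • n) = φ a * g n) (gr : ∀ a n, g (op a • n) = g n * φ a)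
    (h₁ : ∀ m n, φ (I.conv₁ (TensorOver.tmul A m n)) = f m * g n)
    (h₂ : ∀ n m, φ (I.conv₂ (TensorOver.tmul A n m)) = g n * f m) :
    ∃ ι : LaurentTensorAlgebra I →ₐ[ℂ] C, (∀ a, ι (inclA I a) = φ a) ∧
      (∀ m, ι (inclM I m) = f m) ∧ ∀ n, ι (inclN I n) = g n := by
  set Φ : LaurentTensorAlgebra I →ₗ[ℂ] C :=
    elim I (fun k => (powMap φ f fl fr k).1) (fun k => (powMap φ g gl gr (k + 1)).1)
  have pos (k : ℕ) (x) : Φ (embPos I k x) = (powMap φ f fl fr k).1 x := elim_pos I _ _ k x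
  -- Degree zero is included: there both embeddings coincide, and both power maps are `φ`.
  have neg (k : ℕ) (x) : Φ (embNeg I k x) = (powMap φ g gl gr k).1 x := by
    cases k with
    | zero => exact elim_pos I _ _ 0 x
    | succ k => exact elim_neg I _ _ k x
  have unit (a : A) : Φ (embPos I 0 (powUnit a)) = φ a := pos 0 _
  have smul (a : A) (v) : Φ (a • v) = φ a * Φ v := by
    induction v using induction_on with
    | hadd v w hv hw => rw [smul_add, map_add, hv, hw, map_add, mul_add]
    | h0 b => rw [← map_smul, smul_powUnit, unit, unit, map_mul]
    | hpos k m x _ => rw [← map_smul, pos, pos, (powMap φ f fl fr (k + 1)).2]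
    | hneg k n x _ => rw [← map_smul, neg, neg, (powMap φ g gl gr (k + 1)).2]
  -- Only negative degrees have content: `m · (n ⊗ x)` contracts to `conv₁(m ⊗ n) x`, and `h₁`
  -- rewrites `φ(conv₁(m ⊗ n))` as `f m * g n`.
  have mulM (m : M) (v) : Φ (leftMulM I m v) = f m * Φ v := by
    induction v using induction_on with
    | hadd v w hv hw => rw [map_add, map_add, hv, hw, map_add, mul_add]
    | h0 b => rw [leftMulM_pos, pos, pos, powMap_powCons]
    | hpos k m x _ => rw [leftMulM_pos, pos, pos, powMap_powCons]
    | hneg k n x _ => rw [leftMulM_neg, smul, neg, neg, powMap_powCons, h₁, mul_assoc]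
  have mulN (n : N) (v) : Φ (leftMulN I n v) = g n * Φ v := by
    induction v using induction_on with
    | hadd v w hv hw => rw [map_add, map_add, hv, hw, map_add, mul_add]
    | h0 b => rw [← embNeg_zero, leftMulN_neg, neg, neg, powMap_powCons]
    | hpos k m x _ => rw [leftMulN_pos, smul, pos, pos, powMap_powCons, h₂, mul_assoc]
    | hneg k n x _ => rw [leftMulN_neg, neg, neg, powMap_powCons]
  -- Induction on the left factor peels off one tensor factor at a time, leaving the products by
  -- generators treated above.
  have mul (v w) : Φ (v * w) = Φ v * Φ w := by
    rw [mul_def]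
    induction v using induction_on with
    | hadd v v' hv hv' => rw [map_add, LinearMap.add_apply, map_add, hv, hv', map_add, add_mul]
    | h0 b => rw [mulL_unit, smul, unit]
    | hpos k m x ih => rw [mulL_pos, mulM, ih, pos, pos, powMap_powCons, mul_assoc]
    | hneg k n x ih => rw [mulL_neg, mulN, ih, neg, neg, powMap_powCons, mul_assoc]
  refine ⟨AlgHom.ofLinearMap Φ ((unit 1).trans (map_one φ)) mul, unit, fun m => ?_, fun n => ?_⟩
  · rw [AlgHom.ofLinearMap_apply, inclM, pos, powMap_powCons, powMap_zero, map_one, mul_one]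
  · rw [AlgHom.ofLinearMap_apply, inclN, neg, powMap_powCons, powMap_zero, map_one, mul_one]

end UniversalProperty

end LaurentTensorAlgebra

end LaurentAM

namespace LaurentAM

open Topology Filter

/-! ### Arens–Michael algebras and their envelopes -/

section ArensMichael

variable {B : Type u} [Ring B] [Algebra ℂ B] [UniformSpace B]

/-- Submultiplicativity bounds `p(w₁w₂ - z₁z₂)` by `p(w₁ - z₁) p(w₂) + p(z₁) p(w₂ - z₂)`, which
tends to zero as `w → z`. -/
theorem ArensMichaelAlgebra.continuousMul [ArensMichaelAlgebra B] : ContinuousMul B := by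
  obtain ⟨S, hS, hw⟩ := ArensMichaelAlgebra.mconvex (B := B)
  refine ⟨continuous_iff_continuousAt.2 fun z => (hw.tendsto_nhds _ _).2 fun p ε hε => ?_⟩
  have hp : Continuous (p : Seminorm ℂ B) := hw.continuous_seminorm p
  have hg : Continuous fun w : B × B => (p : Seminorm ℂ B) (w.1 - z.1) * (p : Seminorm ℂ B) w.2 +
      (p : Seminorm ℂ B) z.1 * (p : Seminorm ℂ B) (w.2 - z.2) := by fun_prop
  have hz : (p : Seminorm ℂ B) (z.1 - z.1) * (p : Seminorm ℂ B) z.2 +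
      (p : Seminorm ℂ B) z.1 * (p : Seminorm ℂ B) (z.2 - z.2) < ε := by simpa using hε
  filter_upwards [hg.tendsto z (Iio_mem_nhds hz)] with w hlt
  refine lt_of_le_of_lt ?_ hlt
  calc (p : Seminorm ℂ B) (w.1 * w.2 - z.1 * z.2)
      = (p : Seminorm ℂ B) ((w.1 - z.1) * w.2 + z.1 * (w.2 - z.2)) := by
        congr 1; noncomm_ring
    _ ≤ _ := (map_add_le_add _ _ _).trans (add_le_add (hS p p.2 _ _) (hS p p.2 _ _))

theorem ArensMichaelAlgebra.polynormableSpace [ArensMichaelAlgebra B] : PolynormableSpace ℂ B := by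
  obtain ⟨S, -, hw⟩ := ArensMichaelAlgebra.mconvex (B := B)
  exact hw.toPolynormableSpace

/-- A closed subalgebra of an Arens--Michael algebra is an Arens--Michael algebra. -/
theorem ArensMichaelAlgebra.of_isClosed [ArensMichaelAlgebra B] (S : Subalgebra ℂ B)
    (hS : IsClosed (S : Set B)) : ArensMichaelAlgebra S := by
  obtain ⟨T, hT, hw⟩ := ArensMichaelAlgebra.mconvex (B := B)
  have h₀ : IsUniformAddGroup S := S.toSubring.toAddSubgroup.isUniformAddGroup
  have h₁ : CompleteSpace S := hS.completeSpace_coe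
  have hind : IsInducing (S.val.toLinearMap : S → B) := IsInducing.subtypeVal
  have hw' := hind.withSeminorms hw
  refine { mconvex := ⟨Set.range fun p : T => (p : Seminorm ℂ B).comp S.val.toLinearMap, ?_, ?_⟩ }
  · rintro _ ⟨p, rfl⟩ x y
    exact hT p p.2 x y
  -- The restricted seminorms are indexed by `T`, whereas `mconvex` wants them indexed by the set
  -- they form. Each member of one family is bounded by a single member of the other, with constant
  -- `1`.
  · refine hw'.congr ?_ ?_
    · rintro ⟨_, i, rfl⟩
      exact ⟨{i}, 1, by simp; rfl⟩
    · intro i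
      exact ⟨{⟨_, i, rfl⟩}, 1, by simp; rfl⟩

/-- The image of an algebra in its Arens--Michael envelope is dense. -/
theorem IsArensMichaelEnvelope.denseRange {A : Type u} [Ring A] [Algebra ℂ A] {i : A →ₐ[ℂ] B}
    (h : IsArensMichaelEnvelope i) : DenseRange i := by
  have := h.arensMichael
  have := ArensMichaelAlgebra.continuousMul (B := B)
  have : IsTopologicalSemiring B := {}
  set S := i.range.topologicalClosure
  have hS : IsClosed (S : Set B) := i.range.isClosed_topologicalClosure
  have := ArensMichaelAlgebra.of_isClosed S hS
  have hi (a : A) : i a ∈ S := i.range.le_topologicalClosure ⟨a, rfl⟩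
  obtain ⟨ψ, hψ, -⟩ := h.universal S (i.codRestrict S hi)
  -- Both `B → S → B` and the identity extend `i`, so they coincide and every `b` lies in `S`.
  have hid := (h.universal B i).unique
    (y₁ := ⟨S.val.comp ψ.toAlgHom, continuous_subtype_val.comp ψ.cont⟩)
    (y₂ := ContinuousAlgHom.id ℂ B) (fun a => congrArg Subtype.val (hψ a)) (fun a => rfl)
  intro b
  have hb : ((ψ b : S) : B) = b := DFunLike.congr_fun hid b
  have := (ψ b).2
  rw [hb] at this
  exact this

/-- An Arens--Michael envelope is unique up to a unique topological isomorphism. -/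
theorem IsArensMichaelEnvelope.exists_equiv {A E : Type u} [Ring A] [Algebra ℂ A] [Ring E]
    [Algebra ℂ E] [UniformSpace E] {i : A →ₐ[ℂ] B} {j : A →ₐ[ℂ] E}
    (hi : IsArensMichaelEnvelope i) (hj : IsArensMichaelEnvelope j) :
    ∃ e : E ≃A[ℂ] B, ∀ x, e (j x) = i x := by
  have := hi.arensMichael
  have := hj.arensMichael
  obtain ⟨f, hf, -⟩ := hj.universal B i
  obtain ⟨g, hg, -⟩ := hi.universal E j
  have hfg := (hi.universal B i).unique (y₁ := f.comp g) (y₂ := ContinuousAlgHom.id ℂ B)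
    (fun a => (congrArg f (hg a)).trans (hf a)) fun a => rfl
  have hgf := (hj.universal E j).unique (y₁ := g.comp f) (y₂ := ContinuousAlgHom.id ℂ E)
    (fun a => (congrArg g (hf a)).trans (hg a)) fun a => rfl
  exact ⟨{ AlgEquiv.ofAlgHom f.toAlgHom g.toAlgHom
      (AlgHom.ext fun b => DFunLike.congr_fun hfg b)
      (AlgHom.ext fun b => DFunLike.congr_fun hgf b) with
    continuous_toFun := f.cont
    continuous_invFun := g.cont }, hf⟩

end ArensMichael

/-! ### Envelopes of bimodules -/

section Bimodule

variable {A B M E : Type u} [Ring A] [Algebra ℂ A] [Ring B] [Algebra ℂ B]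
    [UniformSpace B] [AddCommGroup M] [Module ℂ M] [Module A M] [Module Aᵐᵒᵖ M]
    [AddCommGroup E] [Module ℂ E] [Module B E] [Module Bᵐᵒᵖ E]
    [UniformSpace E]

/-- The image of a bimodule in its Arens--Michael envelope is dense. -/
theorem IsBimoduleEnvelope.denseRange [IsScalarTower ℂ B E] [IsScalarTower ℂ Bᵐᵒᵖ E]
    [SMulCommClass B Bᵐᵒᵖ E] {i : A →ₐ[ℂ] B} {j : M →ₗ[ℂ] E}
    (h : IsBimoduleEnvelope i j) (hi : IsArensMichaelEnvelope i) : DenseRange j := by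
  have := h.hatBimodule
  have hcl := HatBimodule.continuous_left (R := B) (E := E)
  have hcr := HatBimodule.continuous_right (R := B) (E := E)
  have := (PolynormableSpace.withSeminorms ℂ E).continuousSMul
  set S : Submodule ℂ E := (LinearMap.range j).topologicalClosure
  have hS : IsClosed (S : Set E) := (LinearMap.range j).isClosed_topologicalClosure
  have hj (m : M) : j m ∈ S := (LinearMap.range j).le_topologicalClosure ⟨m, rfl⟩
  have hSj : (S : Set E) = closure (Set.range j) := by
    rw [Submodule.topologicalClosure_coe, LinearMap.coe_range]
  -- Stability of `S` takes two closures. For fixed `m`, the `b` with `b • j m ∈ S` form a closed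
  -- set containing the dense image of `A`, because `i a • j m = j (a • m)`. For fixed `b`, the `x`
  -- with `b • x ∈ S` form a closed set containing the range of `j`.
  have hl (b : B) (x : E) (hx : x ∈ S) : b • x ∈ S := by
    have hd := hi.denseRange
    have h₁ : ∀ (b : B) (m : M), b • j m ∈ S := fun b m =>
      hd.induction_on (p := fun b => b • j m ∈ S) b
        (hS.preimage (continuous_id.smul continuous_const))
        fun a => by rw [← h.isBimoduleHom.1]; exact hj _
    have hc : IsClosed {x : E | b • x ∈ S} := hS.preimage (continuous_const_smul b)
    rw [← SetLike.mem_coe, hSj] at hx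
    exact closure_minimal (by rintro _ ⟨m, rfl⟩; exact h₁ b m) hc hx
  have hr (b : Bᵐᵒᵖ) (x : E) (hx : x ∈ S) : b • x ∈ S := by
    have hd := hi.denseRange
    have h₁ : ∀ (b : B) (m : M), op b • j m ∈ S := fun b m =>
      hd.induction_on (p := fun b => op b • j m ∈ S) b
        (hS.preimage (continuous_op.smul continuous_const))
        fun a => by rw [← h.isBimoduleHom.2]; exact hj _
    have hc : IsClosed {x : E | b • x ∈ S} := hS.preimage (continuous_const_smul b)
    rw [← SetLike.mem_coe, hSj] at hx
    exact closure_minimal (by rintro _ ⟨m, rfl⟩; exact h₁ b.unop m) hc hx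
  let : Module B S :=
    { smul b x := ⟨b • x.1, hl b x.1 x.2⟩
      one_smul x := Subtype.ext (one_smul B x.1)
      mul_smul a b x := Subtype.ext (mul_smul a b x.1)
      smul_zero a := Subtype.ext (smul_zero a)
      smul_add a x y := Subtype.ext (smul_add a x.1 y.1)
      add_smul a b x := Subtype.ext (add_smul a b x.1)
      zero_smul x := Subtype.ext (zero_smul B x.1) }
  let : Module Bᵐᵒᵖ S :=
    { smul b x := ⟨b • x.1, hr b x.1 x.2⟩
      one_smul x := Subtype.ext (one_smul Bᵐᵒᵖ x.1)
      mul_smul a b x := Subtype.ext (mul_smul a b x.1)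
      smul_zero a := Subtype.ext (smul_zero a)
      smul_add a x y := Subtype.ext (smul_add a x.1 y.1)
      add_smul a b x := Subtype.ext (add_smul a b x.1)
      zero_smul x := Subtype.ext (zero_smul Bᵐᵒᵖ x.1) }
  have : IsScalarTower ℂ B S := ⟨fun c b x => Subtype.ext (smul_assoc c b x.1)⟩
  have : IsScalarTower ℂ Bᵐᵒᵖ S := ⟨fun c b x => Subtype.ext (smul_assoc c b x.1)⟩
  have : SMulCommClass B Bᵐᵒᵖ S := ⟨fun a b x => Subtype.ext (smul_comm a b x.1)⟩
  have h₀ : IsUniformAddGroup S := S.toAddSubgroup.isUniformAddGroup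
  have h₁ : CompleteSpace S := hS.completeSpace_coe
  have : HatBimodule B S :=
    { toPolynormableSpace := inferInstance
      continuous_left := ⟨Continuous.subtype_mk
        (continuous_fst.smul (continuous_subtype_val.comp continuous_snd)) _⟩
      continuous_right := ⟨Continuous.subtype_mk
        (continuous_fst.smul (continuous_subtype_val.comp continuous_snd)) _⟩ }
  obtain ⟨g, ⟨hg, hgj⟩, -⟩ := h.universal S (j.codRestrict S hj)
    ⟨fun a m => Subtype.ext (h.isBimoduleHom.1 a m), fun a m => Subtype.ext (h.isBimoduleHom.2 a m)⟩
  -- As for algebras, `E → S → E` and the identity both extend `j`.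
  have hid := (h.universal E j h.isBimoduleHom).unique
    (y₁ := S.subtypeL.comp g) (y₂ := ContinuousLinearMap.id ℂ E)
    ⟨⟨fun a x => congrArg Subtype.val (hg.1 a x), fun a x => congrArg Subtype.val (hg.2 a x)⟩,
      fun m => congrArg Subtype.val (hgj m)⟩
    ⟨⟨fun a x => rfl, fun a x => rfl⟩, fun m => rfl⟩
  intro x
  have hx : ((g x : S) : E) = x := DFunLike.congr_fun hid x
  rw [← hSj, SetLike.mem_coe, ← hx]
  exact (g x).2

/-- A bimodule homomorphism into an Arens--Michael algebra, viewed as a bimodule through a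
continuous homomorphism `ψ`, extends to the bimodule envelope. -/
theorem IsBimoduleEnvelope.exists_extension {C : Type u} [Ring C] [Algebra ℂ C] [UniformSpace C]
    [ArensMichaelAlgebra C] {i : A →ₐ[ℂ] B} {j : M →ₗ[ℂ] E} (h : IsBimoduleEnvelope i j)
    (ψ : B →A[ℂ] C) (f : M →ₗ[ℂ] C) (hl : ∀ a m, f (a • m) = ψ (i a) * f m)
    (hr : ∀ a m, f (op a • m) = f m * ψ (i a)) :
    ∃ g : E →L[ℂ] C, (∀ b x, g (b • x) = ψ b * g x) ∧ (∀ b x, g (op b • x) = g x * ψ b) ∧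
      ∀ m, g (j m) = f m := by
  have hmul := ArensMichaelAlgebra.continuousMul (B := C)
  -- The actions are `b · x = ψ(b) x` and `x · b = x ψ(b)`; they are jointly continuous because `ψ`
  -- and the multiplication of `C` are.
  let : Module B C := Module.compHom C (ψ : B →+* C)
  let : Module Bᵐᵒᵖ C := Module.compHom C (RingHom.op (ψ : B →+* C))
  have sl (b : B) (x : C) : b • x = ψ b * x := rfl
  have sr (b : Bᵐᵒᵖ) (x : C) : b • x = x * ψ b.unop := rfl
  have : IsScalarTower ℂ B C := ⟨fun c b x => by rw [sl, sl, map_smul, smul_mul_assoc]⟩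
  have : IsScalarTower ℂ Bᵐᵒᵖ C :=
    ⟨fun c b x => by rw [sr, sr, unop_smul, map_smul, mul_smul_comm]⟩
  have : SMulCommClass B Bᵐᵒᵖ C := ⟨fun a b x => by rw [sl, sr, sr, sl, mul_assoc]⟩
  have : HatBimodule B C :=
    { toPolynormableSpace := ArensMichaelAlgebra.polynormableSpace
      continuous_left := ⟨(ψ.cont.comp continuous_fst).mul continuous_snd⟩
      continuous_right := ⟨continuous_snd.mul
        (ψ.cont.comp (continuous_unop.comp continuous_fst))⟩ }
  obtain ⟨g, ⟨hg, hgj⟩, -⟩ := h.universal C f ⟨hl, hr⟩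
  exact ⟨g, hg.1, hg.2, hgj⟩

end Bimodule

/-- Two continuous functions of a pair of variables agree if they agree on a product of dense
sets. -/
theorem eq_of_denseRange {X Y M N Z : Type*} [TopologicalSpace M] [TopologicalSpace N]
    [TopologicalSpace Z] [T2Space Z] {i : X → M}
    {j : Y → N} (hi : DenseRange i) (hj : DenseRange j) {f g : M × N → Z} (hf : Continuous f)
    (hg : Continuous g) (h : ∀ x y, f (i x, j y) = g (i x, j y)) (m : M) (n : N) :
    f (m, n) = g (m, n) :=
  congrFun ((hi.prodMap hj).equalizer hf hg (funext fun q => h q.1 q.2)) (m, n)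

/-! ### Joint continuity of the completed tensor product -/

section CompletedTensor

variable {R M N : Type u} [Ring R]
  [AddCommGroup M] [Module ℂ M] [Module Rᵐᵒᵖ M] [TopologicalSpace M] [ContinuousSub M]
  [AddCommGroup N] [Module ℂ N] [Module R N] [TopologicalSpace N] [ContinuousSub N]

variable (R M N) in
-- The defining condition on a seminorm `p` makes `(m, n) ↦ p(m ⊗ n)` continuous, but continuity at
-- `z` concerns `p(w₁ ⊗ w₂ - z₁ ⊗ z₂)`. The difference splits as `(w₁ - z₁) ⊗ w₂ + z₁ ⊗ (w₂ - z₂)`,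
-- and the defining condition applies to each term.
theorem continuous_tmul : Continuous fun q : M × N => TensorOver.tmul R q.1 q.2 := by
  have hw := projective_withSeminorms R M N
  refine continuous_iff_continuousAt.2 fun z => (hw.tendsto_nhds _ _).2 fun p ε hε => ?_
  have hp : Continuous fun q : M × N => p.1 (TensorOver.tmul R q.1 q.2) := p.2
  have h₁ : Continuous fun q : M × N => p.1 (TensorOver.tmul R (q.1 - z.1) q.2) :=
    hp.comp ((continuous_fst.sub continuous_const).prodMk continuous_snd)
  have h₂ : Continuous fun q : M × N => p.1 (TensorOver.tmul R z.1 (q.2 - z.2)) :=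
    hp.comp (continuous_const.prodMk (continuous_snd.sub continuous_const))
  have hz : p.1 (TensorOver.tmul R (z.1 - z.1) z.2) + p.1 (TensorOver.tmul R z.1 (z.2 - z.2))
      < ε := by simpa [TensorOver.tmul] using hε
  filter_upwards [(h₁.add h₂).tendsto z (Iio_mem_nhds hz)] with w hlt
  refine lt_of_le_of_lt ?_ hlt
  refine le_trans (le_of_eq ?_) (map_add_le_add p.1 _ _)
  change p.1 _ = _
  congr 1
  simp [TensorOver.tmul]

variable (R M N) in
theorem continuous_hatTmul : Continuous fun q : M × N => hatTmul R q.1 q.2 :=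
  (UniformSpace.Completion.continuous_coe _).comp (continuous_tmul R M N)

end CompletedTensor

end LaurentAM

/-! ### The envelope of the Laurent tensor algebra -/

theorem proposition2p4
    -- an algebra with a pair of inverse bimodules
    {A M N : Type u} [Ring A] [Algebra ℂ A]
    [AddCommGroup M] [Module ℂ M] [Module A M] [Module Aᵐᵒᵖ M]
    [IsScalarTower ℂ A M] [IsScalarTower ℂ Aᵐᵒᵖ M] [SMulCommClass A Aᵐᵒᵖ M]
    [AddCommGroup N] [Module ℂ N] [Module A N] [Module Aᵐᵒᵖ N]
    [IsScalarTower ℂ A N] [IsScalarTower ℂ Aᵐᵒᵖ N] [SMulCommClass A Aᵐᵒᵖ N]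
    (I : InverseBimodules A M N)
    -- Arens--Michael envelopes of the algebra and of the two bimodules
    {Ahat Mhat Nhat : Type u} [Ring Ahat] [Algebra ℂ Ahat] [UniformSpace Ahat]
    [AddCommGroup Mhat] [Module ℂ Mhat] [Module Ahat Mhat] [Module Ahatᵐᵒᵖ Mhat]
    [IsScalarTower ℂ Ahat Mhat] [IsScalarTower ℂ Ahatᵐᵒᵖ Mhat] [SMulCommClass Ahat Ahatᵐᵒᵖ Mhat]
    [UniformSpace Mhat]
    [AddCommGroup Nhat] [Module ℂ Nhat] [Module Ahat Nhat] [Module Ahatᵐᵒᵖ Nhat]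
    [IsScalarTower ℂ Ahat Nhat] [IsScalarTower ℂ Ahatᵐᵒᵖ Nhat] [SMulCommClass Ahat Ahatᵐᵒᵖ Nhat]
    [UniformSpace Nhat]
    (iA : A →ₐ[ℂ] Ahat) (iM : M →ₗ[ℂ] Mhat) (iN : N →ₗ[ℂ] Nhat)
    (hA : IsArensMichaelEnvelope iA) (hM : IsBimoduleEnvelope iA iM) (hN : IsBimoduleEnvelope iA iN)
    -- they are Fréchet spaces
    (hAF : IsFrechetSpace Ahat) (hMF : IsFrechetSpace Mhat) (hNF : IsFrechetSpace Nhat)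
    -- the bimodule envelopes are topologically inverse, compatibly with the envelope maps
    (J : TopInverseBimodules Ahat Mhat Nhat)
    (hJ₁ : ∀ (m : M) (n : N),
      J.conv₁ (hatTmul Ahat (iM m) (iN n)) = iA (I.conv₁ (TensorOver.tmul A m n)))
    (hJ₂ : ∀ (n : N) (m : M),
      J.conv₂ (hatTmul Ahat (iN n) (iM m)) = iA (I.conv₂ (TensorOver.tmul A n m)))
    -- a topological Laurent tensor algebra of the envelopes
    {Lhat : Type u} [Ring Lhat] [Algebra ℂ Lhat] [UniformSpace Lhat]
    (θ : Ahat →A[ℂ] Lhat) (α : Mhat →L[ℂ] Lhat) (β : Nhat →L[ℂ] Lhat)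
    (hL : IsTopLaurentTensorAlgebra J θ α β) :
    ∃ ι : LaurentTensorAlgebra I →ₐ[ℂ] Lhat,
      (∀ a, ι (LaurentTensorAlgebra.inclA I a) = θ (iA a)) ∧
      (∀ m, ι (LaurentTensorAlgebra.inclM I m) = α (iM m)) ∧
      (∀ n, ι (LaurentTensorAlgebra.inclN I n) = β (iN n)) ∧
      IsArensMichaelEnvelope ι ∧
      ∀ (E : Type u) [Ring E] [Algebra ℂ E] [UniformSpace E] (j : LaurentTensorAlgebra I →ₐ[ℂ] E),
        IsArensMichaelEnvelope j → ∃ e : E ≃A[ℂ] Lhat, ∀ x, e (j x) = ι x := by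
  have hMhat := hM.hatBimodule
  have hNhat := hN.hatBimodule
  have hLAM := hL.arensMichael
  -- The universal triple restricted along the envelope maps is compatible over `A`; `hJ₁` and `hJ₂`
  -- match the two pairs of convolutions.
  obtain ⟨ι, hιA, hιM, hιN⟩ := LaurentTensorAlgebra.exists_algHom I
    (θ.toAlgHom.comp iA) (α.toLinearMap.comp iM) (β.toLinearMap.comp iN)
    (fun a m => (congrArg α (hM.isBimoduleHom.1 a m)).trans (hL.compatible.homM.1 _ _))
    (fun a m => (congrArg α (hM.isBimoduleHom.2 a m)).trans (hL.compatible.homM.2 _ _))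
    (fun a n => (congrArg β (hN.isBimoduleHom.1 a n)).trans (hL.compatible.homN.1 _ _))
    (fun a n => (congrArg β (hN.isBimoduleHom.2 a n)).trans (hL.compatible.homN.2 _ _))
    (fun m n => (congrArg θ (hJ₁ m n)).symm.trans (hL.compatible.comp₁ _ _))
    (fun n m => (congrArg θ (hJ₂ n m)).symm.trans (hL.compatible.comp₂ _ _))
  have hι : IsArensMichaelEnvelope ι := by
    refine ⟨hLAM, fun C _ _ _ _ φ => ?_⟩
    have hmul := ArensMichaelAlgebra.continuousMul (B := C)
    obtain ⟨ψ, hψ, -⟩ := hA.universal C (φ.comp (LaurentTensorAlgebra.inclAHom I))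
    replace hψ (a : A) : ψ (iA a) = φ (LaurentTensorAlgebra.inclA I a) := hψ a
    obtain ⟨f, fl, fr, hf⟩ := hM.exists_extension ψ
      (φ.toLinearMap.comp (LaurentTensorAlgebra.inclMLin I))
      (fun a m => by
        rw [hψ]; exact (congrArg φ (LaurentTensorAlgebra.inclA_mul_inclM I a m).symm).trans
          (map_mul φ _ _))
      (fun a m => by
        rw [hψ]; exact (congrArg φ (LaurentTensorAlgebra.inclM_mul_inclA I a m).symm).trans
          (map_mul φ _ _))
    obtain ⟨g, gl, gr, hg⟩ := hN.exists_extension ψ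
      (φ.toLinearMap.comp (LaurentTensorAlgebra.inclNLin I))
      (fun a n => by
        rw [hψ]; exact (congrArg φ (LaurentTensorAlgebra.inclA_mul_inclN I a n).symm).trans
          (map_mul φ _ _))
      (fun a n => by
        rw [hψ]; exact (congrArg φ (LaurentTensorAlgebra.inclN_mul_inclA I a n).symm).trans
          (map_mul φ _ _))
    replace hf (m : M) : f (iM m) = φ (LaurentTensorAlgebra.inclM I m) := hf m
    replace hg (n : N) : g (iN n) = φ (LaurentTensorAlgebra.inclN I n) := hg n
    have hdM := hM.denseRange hA
    have hdN := hN.denseRange hA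
    -- The convolution relations are known on elements coming from `M` and `N`; density and joint
    -- continuity of both sides extend them to the envelopes.
    have hcomp : IsTopCompatible J ψ f g :=
      { homM := ⟨fl, fr⟩
        homN := ⟨gl, gr⟩
        comp₁ := eq_of_denseRange hdM hdN
          (f := fun q => ψ (J.conv₁ (hatTmul Ahat q.1 q.2))) (g := fun q => f q.1 * g q.2)
          (ψ.cont.comp (J.conv₁.continuous.comp (continuous_hatTmul Ahat Mhat Nhat)))
          ((f.continuous.comp continuous_fst).mul (g.continuous.comp continuous_snd))
          fun m n => by
            rw [hJ₁, hψ, hf, hg, ← map_mul, LaurentTensorAlgebra.inclM_mul_inclN]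
        comp₂ := eq_of_denseRange hdN hdM
          (f := fun q => ψ (J.conv₂ (hatTmul Ahat q.1 q.2))) (g := fun q => g q.1 * f q.2)
          (ψ.cont.comp (J.conv₂.continuous.comp (continuous_hatTmul Ahat Nhat Mhat)))
          ((g.continuous.comp continuous_fst).mul (f.continuous.comp continuous_snd))
          fun n m => by
            rw [hJ₂, hψ, hf, hg, ← map_mul, LaurentTensorAlgebra.inclN_mul_inclM] }
    obtain ⟨F, ⟨hFA, hFM, hFN⟩, hFu⟩ := hL.universal C ψ f g hcomp
    refine ⟨F, fun v => DFunLike.congr_fun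
      (LaurentTensorAlgebra.algHom_ext (f := F.toAlgHom.comp ι) (g := φ)
        (fun a => ?_) (fun m => ?_) fun n => ?_) v, fun G hG => hFu G ⟨?_, ?_, ?_⟩⟩
    · exact ((congrArg F (hιA a)).trans (hFA _)).trans (hψ a)
    · exact ((congrArg F (hιM m)).trans (hFM _)).trans (hf m)
    · exact ((congrArg F (hιN n)).trans (hFN _)).trans (hg n)
    -- Uniqueness: if `G ∘ ι = φ`, then `G ∘ θ`, `G ∘ α`, `G ∘ β` agree with `ψ`, `f`, `g` on dense
    -- images, hence everywhere, and initiality gives `G = F`.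
    · exact congrFun (hA.denseRange.equalizer (G.cont.comp θ.cont) ψ.cont
        (funext fun a => (congrArg G (hιA a)).symm.trans ((hG _).trans (hψ a).symm)))
    · exact congrFun (hdM.equalizer (G.cont.comp α.continuous) f.continuous
        (funext fun m => (congrArg G (hιM m)).symm.trans ((hG _).trans (hf m).symm)))
    · exact congrFun (hdN.equalizer (G.cont.comp β.continuous) g.continuous
        (funext fun n => (congrArg G (hιN n)).symm.trans ((hG _).trans (hg n).symm)))
  exact ⟨ι, hιA, hιM, hιN, hι, fun E _ _ _ j hj => hι.exists_equiv hj⟩
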